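/- Let $K$ be a field of characteristic $p>0$ and let $v:K\to\Gamma\cup\{\infty\}$ be a valuation on $K$ with value group $\Gamma=v(K^\times)$, a linearly ordered abelian group written additively (so $v(x)=\infty$ if and only if $x=0$, $v(xy)=v(x)+v(y)$, and $v(x+y)\ge\min\{v(x),v(y)\}$). Let $\mathcal O_K=\{x\in K: v(x)\ge 0\}$, $\mathfrak m_K=\{x\in K: v(x)>0\}$, $k=\mathcal O_K/\mathfrak m_K$, and regard $(K,v)$ as the three-sorted first-order structure $(K,\Gamma,k)$, consisting of the fields $K$ and $k$ and the ordered group $\Gamma$ together with the valuation $v:K^\times\to\Gamma$ and the quotient map $\pi:\mathcal O_K\to k$. Suppose that the complete theory $T$ of this structure is NIP, i.e. there are no formula $\varphi(\bar x,\bar y)$ and model $M\models T$ containing tuples $(\bar a_i)_{i\in\mathbb N}$ and $(\bar b_I)_{I\subseteq\mathbb N}$ such that $M\models\varphi(\bar a_i,\bar b_I)$ if and only if $i\in I$. Then $\Gamma$ is $p$-divisible: for every $\gamma\in\Gamma$ there is $\delta\in\Gamma$ with $\gamma=p\,\delta$. -/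

import Mathlib

universe u v w

/-! ### The independence property -/

/-- A first-order theory `T` has the independence property if there are a formula `φ(x̄, ȳ)` (with
finite tuples of variables `x̄`, `ȳ`) and a model `M` of `T` containing tuples `a i`, for `i : ℕ`,
and `b I`, for `I ⊆ ℕ`, such that `M ⊨ φ(a i, b I)` if and only if `i ∈ I`.

The models range over a universe `w`. As there are only continuum many tuples involved, the downward
Löwenheim-Skolem theorem shows that for a countable language the choice of `w` is irrelevant. -/
def HasIndependenceProperty {L : FirstOrder.Language.{u, v}} (T : L.Theory) : Prop :=
  ∃ (m n : ℕ) (φ : L.Formula (Fin m ⊕ Fin n)) (M : FirstOrder.Language.Theory.ModelType.{u, v, w} T)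
    (a : ℕ → Fin m → M) (b : Set ℕ → Fin n → M),
    ∀ (i : ℕ) (I : Set ℕ), φ.Realize (Sum.elim (a i) (b I)) ↔ i ∈ I

/-- A theory is NIP (or dependent) if it does not have the independence property. -/
def IsNIP {L : FirstOrder.Language.{u, v}} (T : L.Theory) : Prop :=
  ¬ HasIndependenceProperty.{u, v, w} T

/-! ### Valued fields as three-sorted first-order structures -/

/-- The symbols of the language of valued fields: one predicate for each of the three sorts (field,
value group, residue field), the graphs of the ring operations on the two fields, the graph of the
addition and the order of the value group, and the graphs of the partial maps
`v : K^× → Γ` and `π : 𝒪_K → k`. (The constants `0`, `1` and the subtractions are definable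
from these without parameters.) -/
inductive ValuedFieldRel : ℕ → Type
  | fieldSort : ValuedFieldRel 1
  | valueSort : ValuedFieldRel 1
  | residueSort : ValuedFieldRel 1
  | fieldAdd : ValuedFieldRel 3
  | fieldMul : ValuedFieldRel 3
  | valueAdd : ValuedFieldRel 3
  | valueLE : ValuedFieldRel 2
  | residueAdd : ValuedFieldRel 3
  | residueMul : ValuedFieldRel 3
  | valuation : ValuedFieldRel 2
  | residueMap : ValuedFieldRel 2

/-- The (relational) language of valued fields. Many-sorted structures are treated in the usual way
as one-sorted structures on the disjoint union of the sorts. -/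
def valuedFieldLanguage : FirstOrder.Language.{0, 0} where
  Functions := fun _ => Empty
  Relations := ValuedFieldRel

section ValuedField

variable {K : Type u} [Field K] {Γ : Type v} [AddCommGroup Γ] [LinearOrder Γ]
  [IsOrderedAddMonoid Γ]

/-- The valuation ring `𝒪_K = {x ∈ K | 0 ≤ v x}`. -/
def integerRing (val : AddValuation K (WithTop Γ)) : ValuationSubring K where
  carrier := {x | 0 ≤ val x}
  mul_mem' {x y} hx hy := by
    have h : val (x * y) = val x + val y := val.map_mul x y
    simp only [Set.mem_ofPred_eq] at *
    rw [h]
    exact add_nonneg hx hy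
  one_mem' := by simp
  add_mem' {x y} hx hy := val.map_le_add hx hy
  zero_mem' := by simp
  neg_mem' {x} hx := by
    simp only [Set.mem_ofPred_eq] at *
    rwa [val.map_neg]
  mem_or_inv_mem' x := by
    by_cases hx : x = 0
    · left
      simp [hx]
    · have h : val x + val x⁻¹ = 0 := by
        rw [← val.map_mul, mul_inv_cancel₀ hx, val.map_one]
      rcases le_total 0 (val x) with h0 | h0
      · exact Or.inl h0
      · right
        change 0 ≤ val x⁻¹
        calc (0 : WithTop Γ) = val x + val x⁻¹ := h.symm
          _ ≤ 0 + val x⁻¹ := by gcongr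
          _ = val x⁻¹ := zero_add _

/-- The elements of the three-sorted structure `(K, Γ, k)` attached to a valued field `(K, v)`: the
disjoint union of the field `K`, the value group `Γ`, and the residue field
`k = 𝒪_K / 𝔪_K`. -/
inductive ValuedFieldElement (val : AddValuation K (WithTop Γ)) : Type (max u v)
  | field (x : K)
  | value (γ : Γ)
  | residue (r : IsLocalRing.ResidueField (integerRing val))

namespace ValuedFieldElement

variable (val : AddValuation K (WithTop Γ))

/-- The interpretation of the symbols of the language of valued fields in `(K, Γ, k)`. -/
def relMap : {n : ℕ} → ValuedFieldRel n → (Fin n → ValuedFieldElement val) → Prop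
  | _, .fieldSort, t => ∃ x, t 0 = field x
  | _, .valueSort, t => ∃ γ, t 0 = value γ
  | _, .residueSort, t => ∃ r, t 0 = residue r
  | _, .fieldAdd, t => ∃ x y, t 0 = field x ∧ t 1 = field y ∧ t 2 = field (x + y)
  | _, .fieldMul, t => ∃ x y, t 0 = field x ∧ t 1 = field y ∧ t 2 = field (x * y)
  | _, .valueAdd, t => ∃ γ δ, t 0 = value γ ∧ t 1 = value δ ∧ t 2 = value (γ + δ)
  | _, .valueLE, t => ∃ γ δ, t 0 = value γ ∧ t 1 = value δ ∧ γ ≤ δ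
  | _, .residueAdd, t => ∃ r s, t 0 = residue r ∧ t 1 = residue s ∧ t 2 = residue (r + s)
  | _, .residueMul, t => ∃ r s, t 0 = residue r ∧ t 1 = residue s ∧ t 2 = residue (r * s)
  | _, .valuation, t => ∃ x γ, t 0 = field x ∧ t 1 = value γ ∧ val x = (γ : WithTop Γ)
  | _, .residueMap, t => ∃ x : integerRing val,
      t 0 = field (x : K) ∧ t 1 = residue (IsLocalRing.residue (integerRing val) x)

/-- The three-sorted structure `(K, Γ, k)` of a valued field. -/
instance : valuedFieldLanguage.Structure (ValuedFieldElement val) where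
  funMap := fun f => nomatch f
  RelMap := fun r => relMap val r

end ValuedFieldElement

/-- The valued field `(K, v)` is NIP: the complete theory of the three-sorted structure `(K, Γ, k)`
is NIP. -/
def IsNIPValuedField (val : AddValuation K (WithTop Γ)) : Prop :=
  IsNIP.{0, 0, max u v} (valuedFieldLanguage.completeTheory (ValuedFieldElement val))

end ValuedField

/-! NIP forces the Artin-Schreier map `℘ z = z ^ p - z` to be onto as soon as some `v d < 0`.
Otherwise pick `b` outside its image. Modulo the image Frobenius is the identity, so for suitable `c
i` the classes of the products `c i * t` can be prescribed by solving a Vandermonde system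
(`exists_mul_sub_mem_range_artinSchreier`). Choosing each class to be `0` or that of `b` makes "`c i
* t` is in the image" shatter sets of any finite size, and an ultrapower makes the pattern infinite.

Given `γ < 0`, write an element of value `γ` as `z ^ p - z`. Then `v z < 0`, the term `z ^ p`
dominates, and `γ = p • v z`. Positive `γ` follow by negation. -/

open FirstOrder FirstOrder.Language

/-! ### Finite independence patterns -/

/-- A formula which shatters arbitrarily long finite sequences in `M` witnesses the independence
property of the complete theory of `M`, in an ultrapower of `M`. -/
theorem hasIndependenceProperty_of_finite_patterns {L : FirstOrder.Language.{u, v}} {M : Type w}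
    [L.Structure M] [Nonempty M] {m n : ℕ} (φ : L.Formula (Fin m ⊕ Fin n))
    (h : ∀ N : ℕ, ∃ (a : ℕ → Fin m → M) (b : Set ℕ → Fin n → M),
      ∀ i < N, ∀ I : Set ℕ, φ.Realize (Sum.elim (a i) (b I)) ↔ i ∈ I) :
    HasIndependenceProperty.{u, v, w} (L.completeTheory M) := by
  choose a b hab using h
  let U : Ultrafilter ℕ := Filter.hyperfilter ℕ
  let P : Type w := (U : Filter ℕ).Product fun _ => M
  have hP : P ⊨ L.completeTheory M := by
    refine ⟨fun ψ hψ => ?_⟩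
    rw [Ultraproduct.sentence_realize]
    exact Filter.Eventually.of_forall fun _ => hψ
  refine ⟨m, n, φ, Theory.ModelType.of _ P,
    fun i s => (((fun N => a N i s : ℕ → M) : (U : Filter ℕ).Product fun _ => M) : P),
    fun I s => (((fun N => b N I s : ℕ → M) : (U : Filter ℕ).Product fun _ => M) : P),
    fun i I => ?_⟩
  have key := Ultraproduct.realize_formula_cast (M := fun _ : ℕ => M) (u := U) φ
    (Sum.elim (fun s N => a N i s) (fun s N => b N I s))
  -- `U` is nonprincipal, so almost every finite pattern is long enough to include `i`.
  have hN : ∀ᶠ N in (U : Filter ℕ), i < N :=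
    Nat.hyperfilter_le_atTop (Filter.eventually_gt_atTop i)
  have hpat : (∀ᶠ N in (U : Filter ℕ), φ.Realize
      fun s => Sum.elim (fun s N => a N i s) (fun s N => b N I s) s N) ↔ i ∈ I := by
    have hiff : ∀ᶠ N in (U : Filter ℕ), (φ.Realize
        (fun s => Sum.elim (fun s N => a N i s) (fun s N => b N I s) s N) ↔ i ∈ I) := by
      filter_upwards [hN] with N hN
      rw [← hab N i hN I]
      refine iff_of_eq (congrArg φ.Realize (funext ?_))
      rintro (s | s) <;> rfl
    rw [Filter.eventually_congr hiff]
    simp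
  rw [← hpat, ← key]
  refine iff_of_eq (congrArg φ.Realize (funext ?_))
  rintro (s | s) <;> rfl

/-! ### The Artin-Schreier map -/

/-- The Artin-Schreier map `x ↦ x ^ p - x` of a ring of characteristic `p`. -/
def artinSchreier (R : Type*) [CommRing R] (p : ℕ) [Fact p.Prime] [CharP R p] : R →+ R where
  toFun x := x ^ p - x
  map_zero' := by simp [(Fact.out : p.Prime).ne_zero]
  map_add' x y := by
    rw [add_pow_char]
    ring

section ArtinSchreier

variable {R : Type*} [CommRing R] (p : ℕ) [Fact p.Prime] [CharP R p]

theorem artinSchreier_apply (x : R) : artinSchreier R p x = x ^ p - x := rfl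

/-- The difference telescopes: consecutive Frobenius powers differ by a value of the map. -/
theorem pow_sub_self_mem_range_artinSchreier (x : R) (k : ℕ) :
    x ^ p ^ k - x ∈ (artinSchreier R p).range := by
  induction k with
  | zero => simp
  | succ k ih =>
    have h : x ^ p ^ (k + 1) - x = artinSchreier R p (x ^ p ^ k) + (x ^ p ^ k - x) := by
      rw [artinSchreier_apply, pow_succ, pow_mul]
      ring
    rw [h]
    exact add_mem ⟨_, rfl⟩ ih

/-- If the iterated Frobenius powers of `d` are pairwise distinct, then for suitable coefficients
`c i` the residues of `c i * t` modulo the image of the Artin-Schreier map can be prescribed. -/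
theorem exists_mul_sub_mem_range_artinSchreier {K : Type*} [Field K] [CharP K p] {d : K}
    (hd : Function.Injective fun k : ℕ => d ^ p ^ k) (N : ℕ) :
    ∃ c : Fin N → K, ∀ r : Fin N → K, ∃ t : K, ∀ i,
      c i * t - r i ∈ (artinSchreier K p).range := by
  -- `x k` is a `p ^ k`-th root of `d ^ p ^ N`. Hence `c i * e k ^ p ^ k` is the `p ^ k`-th power of
  -- `x k ^ i * e k`, to which it is congruent modulo the image.
  let x : Fin N → K := fun k => d ^ p ^ (N - (k : ℕ))
  have hx : Function.Injective x := fun k l hkl => by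
    have := hd hkl
    ext
    omega
  have hV : IsUnit (Matrix.vandermonde x).transpose := by
    rw [Matrix.isUnit_transpose, Matrix.isUnit_iff_isUnit_det, isUnit_iff_ne_zero]
    exact Matrix.det_vandermonde_ne_zero_iff.2 hx
  refine ⟨fun i => (d ^ (i : ℕ)) ^ p ^ N, fun r => ?_⟩
  obtain ⟨e, he⟩ := (Matrix.mulVec_surjective_iff_isUnit.2 hV) r
  refine ⟨∑ k : Fin N, e k ^ p ^ (k : ℕ), fun i => ?_⟩
  have hr : r i = ∑ k, x k ^ (i : ℕ) * e k := by
    rw [← he]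
    rfl
  rw [hr, Finset.mul_sum, ← Finset.sum_sub_distrib]
  refine sum_mem fun k _ => ?_
  have h : (d ^ (i : ℕ)) ^ p ^ N * e k ^ p ^ (k : ℕ) = (x k ^ (i : ℕ) * e k) ^ p ^ (k : ℕ) := by
    have hN : p ^ N = p ^ (N - (k : ℕ)) * p ^ (k : ℕ) := by
      rw [← pow_add, Nat.sub_add_cancel k.2.le]
    rw [hN, mul_pow, pow_mul, pow_right_comm d]
  rw [h]
  exact pow_sub_self_mem_range_artinSchreier p _ _

/-- Over a field with an element outside the image of the Artin-Schreier map, membership of `c * t`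
in this image shatters arbitrarily long finite sequences. -/
theorem exists_mul_mem_range_artinSchreier_iff {K : Type*} [Field K] [CharP K p] {b d : K}
    (hb : b ∉ (artinSchreier K p).range)
    (hd : Function.Injective fun k : ℕ => d ^ p ^ k) (N : ℕ) :
    ∃ (c : ℕ → K) (t : Set ℕ → K), ∀ i < N, ∀ I : Set ℕ,
      c i * t I ∈ (artinSchreier K p).range ↔ i ∈ I := by
  classical
  obtain ⟨c, hc⟩ := exists_mul_sub_mem_range_artinSchreier p hd N
  choose t ht using fun I : Set ℕ => hc fun i => if (i : ℕ) ∈ I then 0 else b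
  refine ⟨fun i => if h : i < N then c ⟨i, h⟩ else 0, t, fun i hi I => ?_⟩
  have hmem := ht I ⟨i, hi⟩
  simp only [hi, dite_true]
  by_cases hI : i ∈ I
  · simpa [hI] using hmem
  · simp only [hI, if_false, iff_false] at hmem ⊢
    intro h
    exact hb (by simpa using sub_mem h hmem)

end ArtinSchreier

/-! ### Definability of the Artin-Schreier image -/

section Formulas

/-- The formula `y = x ^ (n + 1)` on the field sort. -/
noncomputable def powFormula : ℕ → valuedFieldLanguage.Formula (Fin 2)
  | 0 => Relations.formula (L := valuedFieldLanguage) ValuedFieldRel.fieldSort ![Term.var 0] ⊓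
      (Term.var 0).equal (Term.var 1)
  | n + 1 => Formula.iExs Unit
      ((powFormula n).relabel ![Sum.inl 0, Sum.inr ()] ⊓
        Relations.formula (L := valuedFieldLanguage) ValuedFieldRel.fieldMul
          ![Term.var (Sum.inr ()), Term.var (Sum.inl 0), Term.var (Sum.inl 1)])

/-- The formula `∃ z, x * y = z ^ (n + 1) - z` on the field sort. -/
noncomputable def artinSchreierFormula (n : ℕ) :
    valuedFieldLanguage.Formula (Fin 1 ⊕ Fin 1) :=
  Formula.iExs (Fin 3)
    (Relations.formula (L := valuedFieldLanguage) ValuedFieldRel.fieldMul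
        ![Term.var (Sum.inl (Sum.inl 0)), Term.var (Sum.inl (Sum.inr 0)), Term.var (Sum.inr 0)] ⊓
      ((powFormula n).relabel ![Sum.inr 1, Sum.inr 2] ⊓
        Relations.formula (L := valuedFieldLanguage) ValuedFieldRel.fieldAdd
          ![Term.var (Sum.inr 0), Term.var (Sum.inr 1), Term.var (Sum.inr 2)]))

variable {K : Type u} [Field K] {Γ : Type v} [AddCommGroup Γ] [LinearOrder Γ]
  [IsOrderedAddMonoid Γ] (val : AddValuation K (WithTop Γ))

open ValuedFieldElement

theorem realize_powFormula (n : ℕ) (s : Fin 2 → ValuedFieldElement val) :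
    (powFormula n).Realize s ↔ ∃ x, s 0 = field x ∧ s 1 = field (x ^ (n + 1)) := by
  induction n generalizing s with
  | zero =>
    rw [powFormula, Formula.realize_inf, Formula.realize_equal]
    change ((∃ x, s 0 = field x) ∧ s 0 = s 1) ↔ _
    constructor
    · rintro ⟨⟨x, hx⟩, h⟩
      exact ⟨x, hx, by rw [← h, hx, zero_add, pow_one]⟩
    · rintro ⟨x, hx, h⟩
      exact ⟨⟨x, hx⟩, by rw [hx, h, zero_add, pow_one]⟩
  | succ n ih =>
    simp only [powFormula, Formula.realize_iExs, Formula.realize_inf, Formula.realize_relabel,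
      ih]
    change (∃ z : Unit → ValuedFieldElement val,
      (∃ x, s 0 = field x ∧ z () = field (x ^ (n + 1))) ∧
        ∃ x y, z () = field x ∧ s 0 = field y ∧ s 1 = field (x * y)) ↔ _
    constructor
    · rintro ⟨z, ⟨x, hx, hz⟩, x', y, hz', hy, h⟩
      obtain rfl : x = y := field.inj (hx.symm.trans hy)
      obtain rfl : x ^ (n + 1) = x' := field.inj (hz.symm.trans hz')
      exact ⟨x, hx, by rw [h, ← pow_succ]⟩
    · rintro ⟨x, hx, h⟩
      exact ⟨fun _ => field (x ^ (n + 1)), ⟨x, hx, rfl⟩, _, x, rfl, hx, by rw [h, pow_succ]⟩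

theorem realize_artinSchreierFormula (n : ℕ) (c t : K) :
    (artinSchreierFormula n).Realize
        (Sum.elim (fun _ => field c) fun _ => field t : _ → ValuedFieldElement val) ↔
      ∃ z, z ^ (n + 1) - z = c * t := by
  simp only [artinSchreierFormula, Formula.realize_iExs, Formula.realize_inf,
    Formula.realize_relabel, realize_powFormula]
  change (∃ s : Fin 3 → ValuedFieldElement val,
    (∃ x y, (field c : ValuedFieldElement val) = field x ∧
      (field t : ValuedFieldElement val) = field y ∧ s 0 = field (x * y)) ∧
    (∃ x, s 1 = field x ∧ s 2 = field (x ^ (n + 1))) ∧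
    ∃ x y, s 0 = field x ∧ s 1 = field y ∧ s 2 = field (x + y)) ↔ _
  constructor
  · rintro ⟨s, ⟨_, _, ⟨⟩, ⟨⟩, h0⟩, ⟨z, h1, h2⟩, x, y, h0', h1', h2'⟩
    obtain rfl : c * t = x := field.inj (h0.symm.trans h0')
    obtain rfl : z = y := field.inj (h1.symm.trans h1')
    have h : z ^ (n + 1) = c * t + z := field.inj (h2.symm.trans h2')
    exact ⟨z, by rw [h, add_sub_cancel_right]⟩
  · rintro ⟨z, hz⟩
    refine ⟨![field (c * t), field z, field (z ^ (n + 1))], ⟨c, t, rfl, rfl, rfl⟩,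
      ⟨z, rfl, rfl⟩, c * t, z, rfl, rfl, ?_⟩
    rw [← hz, sub_add_cancel]
    rfl

/-- The Artin-Schreier map of a NIP valued field is surjective, provided that some element has
pairwise distinct iterated Frobenius powers. -/
theorem artinSchreier_surjective_of_isNIPValuedField (p : ℕ) [Fact p.Prime] [CharP K p]
    (hNIP : IsNIPValuedField val) {d : K} (hd : Function.Injective fun k : ℕ => d ^ p ^ k) :
    Function.Surjective (artinSchreier K p) := by
  intro b
  by_contra hb
  have : Nonempty (ValuedFieldElement val) := ⟨field 0⟩
  -- The formulas encode exponent `n + 1`: starting from exponent 1 avoids defining the constant 1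
  -- in a relational language.
  have hp : p - 1 + 1 = p := Nat.sub_add_cancel (Fact.out : p.Prime).one_le
  refine hNIP (hasIndependenceProperty_of_finite_patterns (artinSchreierFormula (p - 1))
    fun N => ?_)
  obtain ⟨c, t, h⟩ := exists_mul_mem_range_artinSchreier_iff p (b := b) hb hd N
  refine ⟨fun i _ => field (c i), fun I _ => field (t I), fun i hi I => ?_⟩
  rw [realize_artinSchreierFormula, hp]
  exact h i hi I

end Formulas

/-! ### Valuations of Artin-Schreier elements -/

section Valuation

variable {K : Type*} [Field K] {Γ : Type*} [AddCommGroup Γ] [LinearOrder Γ]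
  [IsOrderedAddMonoid Γ] (val : AddValuation K (WithTop Γ))

/-- The values `p ^ k • γ` are already distinct, since an ordered group is torsion-free. -/
theorem injective_pow_pow_of_val_neg {d : K} {γ : Γ} (hd : val d = γ) (hγ : γ < 0) {p : ℕ}
    (hp : 1 < p) : Function.Injective fun k : ℕ => d ^ p ^ k := by
  intro k l hkl
  have h : ((p ^ k • γ : Γ) : WithTop Γ) = ((p ^ l • γ : Γ) : WithTop Γ) := by
    rw [WithTop.coe_nsmul, WithTop.coe_nsmul, ← hd, ← val.map_pow, ← val.map_pow]
    exact congrArg val hkl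
  have h' : p ^ k • (-γ) = p ^ l • (-γ) := by
    rw [smul_neg, smul_neg, WithTop.coe_injective h]
  exact Nat.pow_right_injective hp ((nsmul_left_strictMono (neg_pos.2 hγ)).injective h')

theorem exists_eq_nsmul_of_val_pow_sub_self {z : K} {γ : Γ} {p : ℕ} (hp : 1 < p)
    (hz : val (z ^ p - z) = γ) (hγ : γ < 0) : ∃ δ : Γ, γ = p • δ := by
  have hneg : val z < 0 := by
    by_contra! h
    have : (0 : WithTop Γ) ≤ val (z ^ p - z) :=
      val.map_le_sub (by rw [val.map_pow]; exact nsmul_nonneg h p) h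
    rw [hz] at this
    exact absurd hγ (not_lt.2 (by exact_mod_cast this))
  obtain ⟨δ, hδ⟩ := WithTop.ne_top_iff_exists.1 (hneg.trans_le le_top).ne
  rw [← hδ] at hneg
  have hδ0 : δ < 0 := by exact_mod_cast hneg
  have hpow : val (z ^ p) = ((p • δ : Γ) : WithTop Γ) := by
    rw [val.map_pow, ← hδ, WithTop.coe_nsmul]
  have hlt : val (z ^ p) < val z := by
    rw [hpow, ← hδ, WithTop.coe_lt_coe]
    have := nsmul_left_strictMono (neg_pos.2 hδ0) hp
    simpa using this
  refine ⟨δ, WithTop.coe_injective ?_⟩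
  rw [← hz, val.map_sub_eq_of_lt_left hlt, hpow]

end Valuation

theorem proposition5p4 {K : Type u} [Field K] {Γ : Type v} [AddCommGroup Γ] [LinearOrder Γ]
    [IsOrderedAddMonoid Γ] (val : AddValuation K (WithTop Γ))
    (hval : ∀ γ : Γ, ∃ x : K, val x = (γ : WithTop Γ))
    (p : ℕ) (hp : 0 < p) [CharP K p] (hNIP : IsNIPValuedField val) :
    ∀ γ : Γ, ∃ δ : Γ, γ = p • δ := by
  have hprime : p.Prime := (CharP.char_is_prime_or_zero K p).resolve_right hp.ne'
  have : Fact p.Prime := ⟨hprime⟩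
  have hneg : ∀ γ : Γ, γ < 0 → ∃ δ : Γ, γ = p • δ := by
    intro γ hγ
    obtain ⟨b, hb⟩ := hval γ
    -- `b` serves twice: as the element with distinct Frobenius powers and as the target of the map.
    obtain ⟨z, hz⟩ := artinSchreier_surjective_of_isNIPValuedField val p hNIP
      (injective_pow_pow_of_val_neg val hb hγ hprime.one_lt) b
    rw [artinSchreier_apply] at hz
    exact exists_eq_nsmul_of_val_pow_sub_self val hprime.one_lt (hz ▸ hb) hγ
  intro γ
  rcases lt_trichotomy γ 0 with hγ | rfl | hγ
  · exact hneg γ hγ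
  · exact ⟨0, by simp⟩
  · obtain ⟨δ, hδ⟩ := hneg (-γ) (neg_neg_iff_pos.2 hγ)
    exact ⟨-δ, by rw [smul_neg, ← hδ, neg_neg]⟩
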